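/- Let $F, G$ be natural numbers with $G \ge 1$, let $\epsilon,\gamma,\zeta>0$ and $\eta\ge 0$, let $\mathbf C\in\mathbb R^{F\times G}$, let $\boldsymbol\nu\in\mathbb R^F$ have strictly positive entries, and let $\mathbf u\in\mathbb R^F$. Logarithms and exponentials of vectors and matrices are elementwise, $\odot$ is the elementwise product, $\mathbf 1_G$ is the all-ones vector, and $\langle\cdot,\cdot\rangle$ is the standard inner product. Put $\|\mathbf\Psi\|_{1,\infty}=\max_g\sum_f|\Psi_{f,g}|$ for $\mathbf\Psi\in\mathbb R^{F\times G}$, $\mathbf K=\exp(-\tfrac1\epsilon\mathbf C)$, and consider the problem $$\min_{\boldsymbol\lambda\in\mathbb R^F,\ \mathbf\Psi\in\mathbb R^{F\times G},\ \|\mathbf\Psi\|_{1,\infty}\le\eta}\; J(\boldsymbol\lambda,\mathbf\Psi)=\gamma\zeta\epsilon\Big\langle \mathbf K\odot\exp\big(\tfrac1\epsilon\mathbf\Psi\big),\ \exp\big(\tfrac1\epsilon\boldsymbol\lambda\big)\mathbf 1_G^T\Big\rangle+\big\langle\boldsymbol\nu,\exp(-\gamma\mathbf u-\gamma\zeta\boldsymbol\lambda)\big\rangle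 .\qquad(\mathrm D)$$ Consider the iterative scheme, started from an arbitrary $\mathbf\Psi^0\in\mathbb R^{F\times G}$ (and an arbitrary $\boldsymbol\lambda^0\in\mathbb R^F$, which the scheme does not use), $$\boldsymbol\lambda^{k+1}=\frac{\epsilon}{1+\gamma\zeta\epsilon}\big(\log\boldsymbol\nu_0-\log\boldsymbol\xi^k\big),\qquad \mathbf\Psi^{k+1}=\operatorname*{arg\,min}_{\|\mathbf\Psi\|_{1,\infty}\le\eta}\Big\langle(\mathbf v^{k+1}\mathbf 1_G^T)\odot\mathbf K,\ \exp\big(\tfrac1\epsilon\mathbf\Psi\big)\Big\rangle,$$ where $\boldsymbol\nu_0=\boldsymbol\nu\odot\exp(-\gamma\mathbf u)$, $\boldsymbol\xi^k=\exp(-\tfrac1\epsilon\mathbf C+\tfrac1\epsilon\mathbf\Psi^k)\mathbf 1_G$ and $\mathbf v^{k+1}=\exp(\tfrac1\epsilon\boldsymbol\lambda^{k+1})$. Then: 1. The scheme is exact block-coordinate descent for (D). For every $\mathbf\Psi\in\mathbb R^{F\times G}$, $\frac{\epsilon}{1+\gamma\zeta\epsilon}(\log\boldsymbol\nu_0-\log\boldsymbol\xi)$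 with $\boldsymbol\xi=\exp(-\tfrac1\epsilon\mathbf C+\tfrac1\epsilon\mathbf\Psi)\mathbf 1_G$ is the unique minimizer of $J(\cdot,\mathbf\Psi)$ over $\mathbb R^F$. For every $\boldsymbol\lambda\in\mathbb R^F$, with $\mathbf v=\exp(\tfrac1\epsilon\boldsymbol\lambda)$, the minimization of $\langle(\mathbf v\mathbf 1_G^T)\odot\mathbf K,\exp(\tfrac1\epsilon\mathbf\Psi)\rangle$ over $\|\mathbf\Psi\|_{1,\infty}\le\eta$ has exactly one solution, and a matrix solves it if and only if it minimizes $J(\boldsymbol\lambda,\cdot)$ over the same ball. 2. This last minimization is solved by sorting: if $b^g_{(1)}\ge\dots\ge b^g_{(F)}$ are the numbers $\lambda_f-C_{f,g}$, $f=1,\dots,F$, in non-increasing order, then its solution is $\Psi_{f,g}=-\max(\lambda_f-C_{f,g}-\tau_g,\,0)$ with $\tau_g=\max_{1\le r\le F}\frac1r\big(b^g_{(1)}+\dots+b^g_{(r)}-\eta\big)$. 3. The iterates converge linearly to a solution of (D): there is $\rho\in(0,1)$, not depending on the starting values, such that for every sequence of iterates there are a solution $(\boldsymbol\lambda^\star,\mathbf\Psi^\star)$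 of (D) and a constant $c$ with $\big(\|\boldsymbol\lambda^k-\boldsymbol\lambda^\star\|_2^2+\|\mathbf\Psi^k-\mathbf\Psi^\star\|_F^2\big)^{1/2}\le c\,\rho^k$ for all $k\ge0$. -/

import Mathlib

namespace PitchDual

noncomputable section

/-- The kernel `K = exp(-C / ε)` (elementwise). -/
def kernel {F G : ℕ} (ε : ℝ) (C : Matrix (Fin F) (Fin G) ℝ) : Matrix (Fin F) (Fin G) ℝ :=
  Matrix.of fun f g => Real.exp (-(1 / ε) * C f g)

/-- The matrix `W = exp(Ψ / ε)` (elementwise). -/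
def expPsi {F G : ℕ} (ε : ℝ) (Ψ : Matrix (Fin F) (Fin G) ℝ) : Matrix (Fin F) (Fin G) ℝ :=
  Matrix.of fun f g => Real.exp ((1 / ε) * Ψ f g)

/-- The vector `v = exp(lam / ε)` (elementwise). -/
def expLam {F : ℕ} (ε : ℝ) (lam : Fin F → ℝ) : Fin F → ℝ :=
  fun f => Real.exp ((1 / ε) * lam f)

/-- The standard inner product `⟨A, B⟩ = trace (A Bᵀ)` of two real matrices. -/
def frobInner {F G : ℕ} (A B : Matrix (Fin F) (Fin G) ℝ) : ℝ :=
  ∑ f, ∑ g, A f g * B f g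

/-- The matrix `v 1_Gᵀ`. -/
def spread {F : ℕ} (G : ℕ) (v : Fin F → ℝ) : Matrix (Fin F) (Fin G) ℝ :=
  Matrix.of fun f _ => v f

/-- The mixed norm `‖Ψ‖_{1,∞} = max_g ∑_f |Ψ_{f,g}|`. -/
def mixedNorm {F G : ℕ} (Ψ : Matrix (Fin F) (Fin G) ℝ) : ℝ :=
  ⨆ g, ∑ f, |Ψ f g|

/-- The feasible set `{Ψ : ‖Ψ‖_{1,∞} ≤ η}`. -/
def mixedBall (F G : ℕ) (η : ℝ) : Set (Matrix (Fin F) (Fin G) ℝ) :=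
  {Ψ | mixedNorm Ψ ≤ η}

/-- The objective of the dual problem,
`γ ζ ε ⟨K ⊙ W, v 1_Gᵀ⟩ + ⟨ν, exp(-γ u - γ ζ lam)⟩`. -/
def dualObj {F G : ℕ} (ε γ ζ : ℝ) (C : Matrix (Fin F) (Fin G) ℝ) (ν u : Fin F → ℝ)
    (lam : Fin F → ℝ) (Ψ : Matrix (Fin F) (Fin G) ℝ) : ℝ :=
  γ * ζ * ε * frobInner (Matrix.hadamard (kernel ε C) (expPsi ε Ψ)) (spread G (expLam ε lam))
    + ∑ f, ν f * Real.exp (-γ * u f - γ * ζ * lam f)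

/-- `(lam, Ψ)` solves the dual problem: it minimises the dual objective over all `lam` in `ℝ^F`
and all `Ψ` with `‖Ψ‖_{1,∞} ≤ η`. -/
def IsDualSolution {F G : ℕ} (ε γ ζ η : ℝ) (C : Matrix (Fin F) (Fin G) ℝ) (ν u : Fin F → ℝ)
    (lam : Fin F → ℝ) (Ψ : Matrix (Fin F) (Fin G) ℝ) : Prop :=
  Ψ ∈ mixedBall F G η ∧
    ∀ lam' : Fin F → ℝ, ∀ Ψ' ∈ mixedBall F G η,
      dualObj ε γ ζ C ν u lam Ψ ≤ dualObj ε γ ζ C ν u lam' Ψ'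

/-- `ν₀ = ν ⊙ exp(-γ u)`. -/
def nuZero {F : ℕ} (γ : ℝ) (ν u : Fin F → ℝ) : Fin F → ℝ :=
  fun f => ν f * Real.exp (-γ * u f)

/-- `ξ = exp(-C / ε + Ψ / ε) 1_G`. -/
def xi {F G : ℕ} (ε : ℝ) (C Ψ : Matrix (Fin F) (Fin G) ℝ) : Fin F → ℝ :=
  fun f => ∑ g, Real.exp (-(1 / ε) * C f g + (1 / ε) * Ψ f g)

/-- The closed-form update `ε / (1 + γ ζ ε) (log ν₀ - log ξ)` of the first block. -/
def lamUpdate {F G : ℕ} (ε γ ζ : ℝ) (C : Matrix (Fin F) (Fin G) ℝ) (ν u : Fin F → ℝ)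
    (Ψ : Matrix (Fin F) (Fin G) ℝ) : Fin F → ℝ :=
  fun f => ε / (1 + γ * ζ * ε) * (Real.log (nuZero γ ν u f) - Real.log (xi ε C Ψ f))

/-- The objective `⟨(v 1_Gᵀ) ⊙ K, exp(Ψ / ε)⟩` of the update of the second block,
with `v = exp(lam / ε)`. -/
def psiObj {F G : ℕ} (ε : ℝ) (C : Matrix (Fin F) (Fin G) ℝ) (lam : Fin F → ℝ)
    (Ψ : Matrix (Fin F) (Fin G) ℝ) : ℝ :=
  frobInner (Matrix.hadamard (spread G (expLam ε lam)) (kernel ε C)) (expPsi ε Ψ)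

/-- `Ψ` is a minimiser of `psiObj` over the ball `‖Ψ‖_{1,∞} ≤ η`. -/
def IsPsiUpdate {F G : ℕ} (ε η : ℝ) (C : Matrix (Fin F) (Fin G) ℝ) (lam : Fin F → ℝ)
    (Ψ : Matrix (Fin F) (Fin G) ℝ) : Prop :=
  Ψ ∈ mixedBall F G η ∧ IsMinOn (psiObj ε C lam) (mixedBall F G η) Ψ

/-- The sequences `lam k`, `Psi k` are iterates of the scheme. The starting value `Psi 0` is
arbitrary, and `lam 0` plays no role. -/
def IsIterates {F G : ℕ} (ε γ ζ η : ℝ) (C : Matrix (Fin F) (Fin G) ℝ) (ν u : Fin F → ℝ)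
    (lam : ℕ → Fin F → ℝ) (Psi : ℕ → Matrix (Fin F) (Fin G) ℝ) : Prop :=
  ∀ k, lam (k + 1) = lamUpdate ε γ ζ C ν u (Psi k) ∧
    IsPsiUpdate ε η C (lam (k + 1)) (Psi (k + 1))

/-- The threshold read off from a vector `b` whose entries are already in non-increasing order:
`max_{1 ≤ r ≤ F} (b_1 + ... + b_r - η) / r`. -/
def sortedThreshold {F : ℕ} (η : ℝ) (b : Fin F → ℝ) : ℝ :=
  ⨆ r : Fin F, ((∑ i ∈ Finset.Iic r, b i) - η) / ((r : ℕ) + 1 : ℝ)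

/-- Euclidean distance between two pairs of dual variables. -/
def pairDist {F G : ℕ} (lam : Fin F → ℝ) (Ψ : Matrix (Fin F) (Fin G) ℝ)
    (lam' : Fin F → ℝ) (Ψ' : Matrix (Fin F) (Fin G) ℝ) : ℝ :=
  Real.sqrt (∑ f, (lam f - lam' f) ^ 2 + ∑ f, ∑ g, (Ψ f g - Ψ' f g) ^ 2)

end

end PitchDual

/-! Everything is convex, so first-order conditions decide. With `Ψ` fixed, the objective separates
over `f` into sums of two exponentials, and `lamUpdate` is its stationary point. With `lam` fixed,
truncating each column of `lam f - C f g` at a level where the removed mass is exactly `η` satisfies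
the variational inequality of the ball. Tangent lines of `exp` lie strictly below its graph, which
gives optimality and uniqueness in both blocks.

For the rate, the arguments of the exponentials are confined to a fixed interval, since the ball is
compact and `lamUpdate` is continuous. There the objective is jointly strongly convex and smooth in
`lam`. At a point optimal in `Ψ`, the `Ψ`-part of the gradient can only help
(`dualObj_strong_lower`), so a step of length `t` towards a solution in `lam` alone multiplies the
gap by at most `1 - t`. Exact minimisation in `lam` does at least as well
(`dualObj_lamUpdate_contract`), and the `Ψ` update does not increase the objective. Strong convexity
at the solution turns the gap into squared distance (`exists_pairDist_sq_le`), hence the rate `√(1 -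
t)`. -/

namespace PitchDual

open Finset

/-! ### Quadratic bounds for the exponential -/

section ExpBounds

lemma monotone_exp_sub_quadratic : Monotone fun z : ℝ => Real.exp z - 1 - z - z ^ 2 / 2 := by
  have hd : ∀ z : ℝ, HasDerivAt (fun z : ℝ => Real.exp z - 1 - z - z ^ 2 / 2)
      (Real.exp z - 1 - z) z := by
    intro z
    have h := (((Real.hasDerivAt_exp z).sub_const 1).sub (hasDerivAt_id z)).sub
      (((hasDerivAt_id z).pow 2).div_const 2)
    refine h.congr_deriv ?_
    simp
  refine monotone_of_deriv_nonneg (fun z => (hd z).differentiableAt) fun z => ?_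
  rw [(hd z).deriv]
  linarith [Real.add_one_le_exp z]

/-- Like the previous function, this one vanishes at `0`, so monotonicity gives its sign on each
side. The two serve as second-order Taylor estimates expanded at either endpoint, for the lower and
the upper bound alike. -/
lemma monotone_one_sub_mul_exp : Monotone fun s : ℝ => 1 - (1 - s) * Real.exp s - s ^ 2 / 2 := by
  have hd : ∀ s : ℝ, HasDerivAt (fun s : ℝ => 1 - (1 - s) * Real.exp s - s ^ 2 / 2)
      (s * (Real.exp s - 1)) s := by
    intro s
    have h := ((((hasDerivAt_id s).const_sub 1).mul (Real.hasDerivAt_exp s)).const_sub 1).sub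
      (((hasDerivAt_id s).pow 2).div_const 2)
    refine h.congr_deriv ?_
    simp
    ring
  refine monotone_of_deriv_nonneg (fun z => (hd z).differentiableAt) fun s => ?_
  rw [(hd s).deriv]
  rcases le_total 0 s with hs | hs
  · exact mul_nonneg hs (by linarith [Real.one_le_exp hs])
  · exact mul_nonneg_of_nonpos_of_nonpos hs (by linarith [Real.exp_le_one_iff.2 hs])

lemma exp_lower_bound {R x y : ℝ} (hx : -R ≤ x) (hy : -R ≤ y) :
    Real.exp x + Real.exp x * (y - x) + Real.exp (-R) / 2 * (y - x) ^ 2 ≤ Real.exp y := by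
  have hex : Real.exp (-R) ≤ Real.exp x := Real.exp_le_exp.2 hx
  have hey : Real.exp (-R) ≤ Real.exp y := Real.exp_le_exp.2 hy
  have hxy : Real.exp y = Real.exp x * Real.exp (y - x) := by rw [← Real.exp_add]; ring_nf
  have hyx : Real.exp x = Real.exp y * Real.exp (x - y) := by rw [← Real.exp_add]; ring_nf
  have hq := sq_nonneg (y - x)
  -- The curvature of `exp` on the segment is smallest at its left end, so the factor taken out is
  -- `exp x` or `exp y`, whichever is smaller.
  rcases le_total x y with h | h
  · have h1 := monotone_exp_sub_quadratic (sub_nonneg.2 h)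
    simp only [Real.exp_zero] at h1
    have h2 := mul_nonneg (Real.exp_pos x).le (by linarith :
      0 ≤ Real.exp (y - x) - 1 - (y - x) - (y - x) ^ 2 / 2)
    nlinarith
  · have h1 := monotone_one_sub_mul_exp (sub_nonneg.2 h)
    simp only [Real.exp_zero] at h1
    have h2 := mul_nonneg (Real.exp_pos y).le (by linarith :
      0 ≤ 1 - (1 - (x - y)) * Real.exp (x - y) - (x - y) ^ 2 / 2)
    have h3 : Real.exp y * (1 - (1 - (x - y)) * Real.exp (x - y) - (x - y) ^ 2 / 2)
      = Real.exp y - (1 - (x - y)) * Real.exp x - Real.exp y * ((y - x) ^ 2 / 2) := by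
      rw [hyx]; ring
    nlinarith

lemma exp_upper_bound {R x y : ℝ} (hx : x ≤ R) (hy : y ≤ R) :
    Real.exp y ≤ Real.exp x + Real.exp x * (y - x) + Real.exp R / 2 * (y - x) ^ 2 := by
  have hex : Real.exp x ≤ Real.exp R := Real.exp_le_exp.2 hx
  have hey : Real.exp y ≤ Real.exp R := Real.exp_le_exp.2 hy
  have hxy : Real.exp y = Real.exp x * Real.exp (y - x) := by rw [← Real.exp_add]; ring_nf
  have hyx : Real.exp x = Real.exp y * Real.exp (x - y) := by rw [← Real.exp_add]; ring_nf
  have hq := sq_nonneg (y - x)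
  -- Here the curvature is bounded by its value at the right end, so the larger exponential is taken
  -- out.
  rcases le_total y x with h | h
  · have h1 := monotone_exp_sub_quadratic (sub_nonpos.2 h)
    simp only [Real.exp_zero] at h1
    have h2 := mul_nonneg (Real.exp_pos x).le (by linarith :
      0 ≤ -(Real.exp (y - x) - 1 - (y - x) - (y - x) ^ 2 / 2))
    nlinarith
  · have h1 := monotone_one_sub_mul_exp (sub_nonpos.2 h)
    simp only [Real.exp_zero] at h1
    have h2 := mul_nonneg (Real.exp_pos y).le (by linarith :
      0 ≤ -(1 - (1 - (x - y)) * Real.exp (x - y) - (x - y) ^ 2 / 2))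
    have h3 : Real.exp y * -(1 - (1 - (x - y)) * Real.exp (x - y) - (x - y) ^ 2 / 2)
      = -(Real.exp y - (1 - (x - y)) * Real.exp x - Real.exp y * ((y - x) ^ 2 / 2)) := by
      rw [hyx]; ring
    nlinarith

lemma exp_tangent_le (x y : ℝ) : Real.exp x + Real.exp x * (y - x) ≤ Real.exp y := by
  have hxy : Real.exp y = Real.exp x * Real.exp (y - x) := by rw [← Real.exp_add]; ring_nf
  nlinarith [Real.add_one_le_exp (y - x), Real.exp_pos x]

lemma exp_tangent_lt {x y : ℝ} (h : x ≠ y) :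
    Real.exp x + Real.exp x * (y - x) < Real.exp y := by
  have hxy : Real.exp y = Real.exp x * Real.exp (y - x) := by rw [← Real.exp_add]; ring_nf
  have := Real.add_one_lt_exp (sub_ne_zero.2 h.symm)
  nlinarith [Real.exp_pos x]

end ExpBounds

/-! ### The sorting threshold -/

section Threshold

variable {F : ℕ} {η : ℝ} {b : Fin F → ℝ}

lemma sum_Iic_sub_le_sortedThreshold (r : Fin F) :
    ∑ i ∈ Iic r, (b i - sortedThreshold η b) ≤ η := by
  have h : ((∑ i ∈ Iic r, b i) - η) / ((r : ℕ) + 1 : ℝ) ≤ sortedThreshold η b :=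
    le_ciSup (f := fun r : Fin F => ((∑ i ∈ Iic r, b i) - η) / ((r : ℕ) + 1 : ℝ))
      (Set.finite_range _).bddAbove r
  rw [div_le_iff₀ (by positivity)] at h
  rw [sum_sub_distrib, sum_const, Fin.card_Iic, nsmul_eq_mul]
  push_cast
  linarith

lemma exists_sum_Iic_sub_sortedThreshold_eq (hF : 0 < F) :
    ∃ r : Fin F, ∑ i ∈ Iic r, (b i - sortedThreshold η b) = η := by
  have : Nonempty (Fin F) := ⟨⟨0, hF⟩⟩
  obtain ⟨r, hr⟩ := exists_eq_ciSup_of_finite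
    (f := fun r : Fin F => ((∑ i ∈ Iic r, b i) - η) / ((r : ℕ) + 1 : ℝ))
  refine ⟨r, ?_⟩
  change _ = sortedThreshold η b at hr
  rw [div_eq_iff (by positivity)] at hr
  rw [sum_sub_distrib, sum_const, Fin.card_Iic, nsmul_eq_mul]
  push_cast
  linarith

/-- The positive parts above the threshold add up to exactly `η`. -/
lemma sum_max_sub_sortedThreshold (hF : 0 < F) (hη : 0 ≤ η) (hb : Antitone b) :
    ∑ i, max (b i - sortedThreshold η b) 0 = η := by
  set τ := sortedThreshold η b with hτ
  apply le_antisymm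
  · rcases (univ.filter fun i => τ < b i).eq_empty_or_nonempty with he | hne
    · rw [sum_eq_zero]
      · exact hη
      · intro i _
        have : i ∉ univ.filter fun i => τ < b i := by simp [he]
        simp only [mem_filter, mem_univ, true_and, not_lt] at this
        exact max_eq_right (by linarith)
    -- Since `b` is non-increasing, the entries above `τ` form the initial segment `Iic r`;
    -- maximality of `τ` bounds its excess by `η`.
    · set r := (univ.filter fun i => τ < b i).max' hne with hr
      have hrm : τ < b r := by
        have := (univ.filter fun i => τ < b i).max'_mem hne
        simpa using this
      refine le_trans (le_of_eq ?_) (sum_Iic_sub_le_sortedThreshold (η := η) (b := b) r)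
      rw [← sum_subset (subset_univ (Iic r))]
      · refine sum_congr rfl fun i hi => max_eq_left ?_
        have := hb (mem_Iic.1 hi)
        linarith
      · intro i _ hi
        refine max_eq_right ?_
        by_contra hcon
        refine hi (mem_Iic.2 (le_max' _ _ ?_))
        simp only [mem_filter, mem_univ, true_and]
        linarith
  -- The index attaining the maximum has excess exactly `η`, and positive parts only add to it.
  · obtain ⟨r, hr⟩ := exists_sum_Iic_sub_sortedThreshold_eq (η := η) (b := b) hF
    calc η = ∑ i ∈ Iic r, (b i - τ) := hr.symm
      _ ≤ ∑ i ∈ Iic r, max (b i - τ) 0 := sum_le_sum fun i _ => le_max_left _ _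
      _ ≤ ∑ i, max (b i - τ) 0 :=
        sum_le_sum_of_subset_of_nonneg (subset_univ _) fun i _ _ => le_max_right _ _

end Threshold

/-! ### Optimality of truncation in one column -/

section Column

/-- Variational inequality for the truncation of a vector at the level `τ`. -/
lemma truncation_variational {ι : Type*} [Fintype ι] {ε η τ : ℝ} (hε : 0 < ε) {b : ι → ℝ}
    (hτ : ∑ i, max (b i - τ) 0 = η) {p : ι → ℝ} (hp : ∑ i, |p i| ≤ η) :
    0 ≤ ∑ i, Real.exp ((1 / ε) * (b i + -max (b i - τ) 0)) * (p i - -max (b i - τ) 0) := by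
  -- `exp(τ / ε)` acts as the Lagrange multiplier: the exponent is `min (b i) τ`, so the weight
  -- equals it on truncated entries and is at most it elsewhere.
  have hterm : ∀ i, Real.exp ((1 / ε) * τ) * (max (b i - τ) 0 - |p i|) ≤
      Real.exp ((1 / ε) * (b i + -max (b i - τ) 0)) * (p i - -max (b i - τ) 0) := by
    intro i
    rcases le_total (b i - τ) 0 with h | h
    · rw [max_eq_right h]
      have h1 : Real.exp ((1 / ε) * (b i + -0)) ≤ Real.exp ((1 / ε) * τ) :=
        Real.exp_le_exp.2 (mul_le_mul_of_nonneg_left (by linarith) (by positivity))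
      have h2 := Real.exp_pos ((1 / ε) * (b i + -0))
      nlinarith [neg_abs_le (p i), abs_nonneg (p i)]
    · rw [max_eq_left h, show b i + -(b i - τ) = τ by ring]
      refine mul_le_mul_of_nonneg_left ?_ (Real.exp_pos _).le
      linarith [neg_abs_le (p i)]
  refine le_trans ?_ (sum_le_sum fun i _ => hterm i)
  rw [← mul_sum, sum_sub_distrib, hτ]
  exact mul_nonneg (Real.exp_pos _).le (by linarith)

end Column

/-! ### Exact minimisation in each block -/

section Blocks

variable {F G : ℕ} {ε γ ζ η : ℝ} {C : Matrix (Fin F) (Fin G) ℝ} {ν u : Fin F → ℝ}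

lemma mem_mixedBall_iff (hG : 0 < G) {Ψ : Matrix (Fin F) (Fin G) ℝ} :
    Ψ ∈ mixedBall F G η ↔ ∀ g, ∑ f, |Ψ f g| ≤ η := by
  have : Nonempty (Fin G) := ⟨⟨0, hG⟩⟩
  exact ciSup_le_iff (f := fun g => ∑ f, |Ψ f g|) (Set.finite_range _).bddAbove

lemma psiObj_eq (lam : Fin F → ℝ) (Ψ : Matrix (Fin F) (Fin G) ℝ) :
    psiObj ε C lam Ψ = ∑ f, ∑ g, Real.exp ((1 / ε) * (lam f - C f g + Ψ f g)) := by
  unfold psiObj frobInner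
  refine sum_congr rfl fun f _ => sum_congr rfl fun g _ => ?_
  simp only [Matrix.hadamard_apply, spread, kernel, expPsi, expLam, Matrix.of_apply,
    ← Real.exp_add]
  ring_nf

lemma dualObj_eq_psiObj (lam : Fin F → ℝ) (Ψ : Matrix (Fin F) (Fin G) ℝ) :
    dualObj ε γ ζ C ν u lam Ψ = γ * ζ * ε * psiObj ε C lam Ψ
      + ∑ f, ν f * Real.exp (-γ * u f - γ * ζ * lam f) := by
  unfold dualObj psiObj frobInner
  congr 2
  refine sum_congr rfl fun f _ => sum_congr rfl fun g _ => ?_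
  simp only [Matrix.hadamard_apply]
  ring

lemma dualObj_eq (lam : Fin F → ℝ) (Ψ : Matrix (Fin F) (Fin G) ℝ) :
    dualObj ε γ ζ C ν u lam Ψ =
      γ * ζ * ε * ∑ f, ∑ g, Real.exp ((1 / ε) * (lam f - C f g + Ψ f g))
      + ∑ f, nuZero γ ν u f * Real.exp (-(γ * ζ) * lam f) := by
  rw [dualObj_eq_psiObj, psiObj_eq]
  congr 1
  refine sum_congr rfl fun f _ => ?_
  rw [nuZero, mul_assoc (ν f), ← Real.exp_add]
  ring_nf

lemma nuZero_pos (hν : ∀ f, 0 < ν f) (f : Fin F) : 0 < nuZero γ ν u f :=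
  mul_pos (hν f) (Real.exp_pos _)

lemma xi_pos (hG : 0 < G) (Ψ : Matrix (Fin F) (Fin G) ℝ) (f : Fin F) : 0 < xi ε C Ψ f :=
  sum_pos (fun _ _ => Real.exp_pos _) ⟨⟨0, hG⟩, mem_univ _⟩

lemma sum_exp_eq_mul_xi (lam : Fin F → ℝ) (Ψ : Matrix (Fin F) (Fin G) ℝ) (f : Fin F) :
    ∑ g, Real.exp ((1 / ε) * (lam f - C f g + Ψ f g)) =
      xi ε C Ψ f * Real.exp ((1 / ε) * lam f) := by
  rw [xi, sum_mul]
  refine sum_congr rfl fun g _ => ?_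
  rw [← Real.exp_add]
  ring_nf

/-- Stationarity of the closed-form first-block update. -/
lemma lamUpdate_stationary (hG : 0 < G) (hε : 0 < ε) (hγ : 0 < γ) (hζ : 0 < ζ)
    (hν : ∀ f, 0 < ν f) (Ψ : Matrix (Fin F) (Fin G) ℝ) (f : Fin F) :
    xi ε C Ψ f * Real.exp ((1 / ε) * lamUpdate ε γ ζ C ν u Ψ f) =
      nuZero γ ν u f * Real.exp (-(γ * ζ) * lamUpdate ε γ ζ C ν u Ψ f) := by
  have hx := xi_pos (ε := ε) (C := C) hG Ψ f
  have hn := nuZero_pos (γ := γ) (u := u) hν f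
  have hp : 0 < 1 + γ * ζ * ε := by positivity
  conv_lhs => rw [← Real.exp_log hx, ← Real.exp_add]
  conv_rhs => rw [← Real.exp_log hn, ← Real.exp_add]
  simp only [lamUpdate]
  congr 1
  field_simp
  ring

lemma dualObj_lamUpdate_lt (hG : 0 < G) (hε : 0 < ε) (hγ : 0 < γ) (hζ : 0 < ζ)
    (hν : ∀ f, 0 < ν f) {Ψ : Matrix (Fin F) (Fin G) ℝ} {lam : Fin F → ℝ}
    (hne : lam ≠ lamUpdate ε γ ζ C ν u Ψ) :
    dualObj ε γ ζ C ν u (lamUpdate ε γ ζ C ν u Ψ) Ψ < dualObj ε γ ζ C ν u lam Ψ := by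
  set m := lamUpdate ε γ ζ C ν u Ψ with hm
  simp only [dualObj_eq, sum_exp_eq_mul_xi]
  rw [mul_sum, mul_sum, ← sum_add_distrib, ← sum_add_distrib]
  have hA : 0 < γ * ζ * ε := by positivity
  have hst := fun f => lamUpdate_stationary (C := C) (u := u) hG hε hγ hζ hν Ψ f
  rw [← hm] at hst
  -- By stationarity the slopes of the two tangent lines at `m f` cancel.
  have key : ∀ f, γ * ζ * ε * (xi ε C Ψ f * (Real.exp ((1 / ε) * m f)
        + Real.exp ((1 / ε) * m f) * ((1 / ε) * lam f - (1 / ε) * m f)))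
      + nuZero γ ν u f * (Real.exp (-(γ * ζ) * m f)
        + Real.exp (-(γ * ζ) * m f) * (-(γ * ζ) * lam f - -(γ * ζ) * m f))
      = γ * ζ * ε * (xi ε C Ψ f * Real.exp ((1 / ε) * m f))
        + nuZero γ ν u f * Real.exp (-(γ * ζ) * m f) := by
    intro f
    have : γ * ζ * ε * (xi ε C Ψ f * (Real.exp ((1 / ε) * m f)
        * ((1 / ε) * lam f - (1 / ε) * m f))) =
        γ * ζ * (xi ε C Ψ f * Real.exp ((1 / ε) * m f)) * (lam f - m f) := by
      field_simp
    rw [hst] at this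
    linear_combination this
  refine sum_lt_sum (fun f _ => ?_) ?_
  · rw [← key f]
    exact add_le_add
      (mul_le_mul_of_nonneg_left (mul_le_mul_of_nonneg_left (exp_tangent_le _ _)
        (xi_pos hG Ψ f).le) hA.le)
      (mul_le_mul_of_nonneg_left (exp_tangent_le _ _) (nuZero_pos hν f).le)
  · obtain ⟨f, hf⟩ := Function.ne_iff.1 hne
    refine ⟨f, mem_univ _, ?_⟩
    rw [← key f]
    refine add_lt_add_of_lt_of_le
      (mul_lt_mul_of_pos_left (mul_lt_mul_of_pos_left (exp_tangent_lt ?_) (xi_pos hG Ψ f)) hA)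
      (mul_le_mul_of_nonneg_left (exp_tangent_le _ _) (nuZero_pos hν f).le)
    intro h
    exact hf (mul_left_cancel₀ (by positivity : (1 / ε) ≠ 0) h).symm

lemma dualObj_lamUpdate_le (hG : 0 < G) (hε : 0 < ε) (hγ : 0 < γ) (hζ : 0 < ζ)
    (hν : ∀ f, 0 < ν f) (Ψ : Matrix (Fin F) (Fin G) ℝ) (lam : Fin F → ℝ) :
    dualObj ε γ ζ C ν u (lamUpdate ε γ ζ C ν u Ψ) Ψ ≤ dualObj ε γ ζ C ν u lam Ψ := by
  by_cases h : lam = lamUpdate ε γ ζ C ν u Ψ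
  · rw [h]
  · exact (dualObj_lamUpdate_lt hG hε hγ hζ hν h).le

lemma eq_lamUpdate_iff (hG : 0 < G) (hε : 0 < ε) (hγ : 0 < γ) (hζ : 0 < ζ)
    (hν : ∀ f, 0 < ν f) (Ψ : Matrix (Fin F) (Fin G) ℝ) (lam : Fin F → ℝ) :
    lam = lamUpdate ε γ ζ C ν u Ψ ↔ ∀ lam' : Fin F → ℝ,
      dualObj ε γ ζ C ν u lam Ψ ≤ dualObj ε γ ζ C ν u lam' Ψ := by
  refine ⟨fun h lam' => h ▸ dualObj_lamUpdate_le hG hε hγ hζ hν Ψ lam', fun h => ?_⟩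
  by_contra hne
  exact (dualObj_lamUpdate_lt hG hε hγ hζ hν hne).not_ge (h _)

lemma isPsiUpdate_iff_dualObj (hε : 0 < ε) (hγ : 0 < γ) (hζ : 0 < ζ) (lam : Fin F → ℝ)
    (Ψ : Matrix (Fin F) (Fin G) ℝ) :
    IsPsiUpdate ε η C lam Ψ ↔ Ψ ∈ mixedBall F G η ∧ ∀ Ψ' ∈ mixedBall F G η,
      dualObj ε γ ζ C ν u lam Ψ ≤ dualObj ε γ ζ C ν u lam Ψ' := by
  have hA : 0 < γ * ζ * ε := by positivity
  refine and_congr_right fun _ => forall₂_congr fun Ψ' _ => ?_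
  simp only [dualObj_eq_psiObj, add_le_add_iff_right, Set.mem_ofPred_eq]
  exact (mul_le_mul_iff_of_pos_left hA).symm

/-- The second-block update, computed by sorting the columns with the permutations `σ`. -/
noncomputable def sortedPsi (η : ℝ) (C : Matrix (Fin F) (Fin G) ℝ) (lam : Fin F → ℝ)
    (σ : Fin G → Equiv.Perm (Fin F)) : Matrix (Fin F) (Fin G) ℝ :=
  Matrix.of fun f g => -max (lam f - C f g -
    sortedThreshold η (fun i => lam (σ g i) - C (σ g i) g)) 0

/-- The first-order optimality condition of the second block. -/
def PsiVariational (ε η : ℝ) (C : Matrix (Fin F) (Fin G) ℝ) (lam : Fin F → ℝ)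
    (Ψ : Matrix (Fin F) (Fin G) ℝ) : Prop :=
  ∀ Ψ' ∈ mixedBall F G η,
    0 ≤ ∑ f, ∑ g, Real.exp ((1 / ε) * (lam f - C f g + Ψ f g)) * (Ψ' f g - Ψ f g)

lemma sortedPsi_mass {lam : Fin F → ℝ} {σ : Fin G → Equiv.Perm (Fin F)} (hF : 0 < F)
    (hη : 0 ≤ η) {g : Fin G} (hσ : Antitone fun i => lam (σ g i) - C (σ g i) g) :
    ∑ f, max (lam f - C f g - sortedThreshold η (fun i => lam (σ g i) - C (σ g i) g)) 0 = η := by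
  rw [← Equiv.sum_comp (σ g)]
  exact sum_max_sub_sortedThreshold hF hη hσ

lemma sortedPsi_mem_mixedBall (hG : 0 < G) (hη : 0 ≤ η) {lam : Fin F → ℝ}
    {σ : Fin G → Equiv.Perm (Fin F)} (hσ : ∀ g, Antitone fun i => lam (σ g i) - C (σ g i) g) :
    sortedPsi η C lam σ ∈ mixedBall F G η := by
  rw [mem_mixedBall_iff hG]
  intro g
  rcases F.eq_zero_or_pos with rfl | hF
  · simpa using hη
  · simp only [sortedPsi, Matrix.of_apply, abs_neg, abs_of_nonneg (le_max_right _ (0 : ℝ))]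
    exact (sortedPsi_mass hF hη (hσ g)).le

lemma sortedPsi_variational (hG : 0 < G) (hε : 0 < ε) (hη : 0 ≤ η) {lam : Fin F → ℝ}
    {σ : Fin G → Equiv.Perm (Fin F)} (hσ : ∀ g, Antitone fun i => lam (σ g i) - C (σ g i) g) :
    PsiVariational ε η C lam (sortedPsi η C lam σ) := by
  intro Ψ' hΨ'
  rw [mem_mixedBall_iff hG] at hΨ'
  rw [sum_comm]
  refine sum_nonneg fun g _ => ?_
  rcases F.eq_zero_or_pos with rfl | hF
  · simp
  · exact truncation_variational hε (sortedPsi_mass hF hη (hσ g)) (hΨ' g)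

lemma PsiVariational.psiObj_lt (hε : 0 < ε) {lam : Fin F → ℝ}
    {Ψ Ψ' : Matrix (Fin F) (Fin G) ℝ} (h : PsiVariational ε η C lam Ψ)
    (hΨ' : Ψ' ∈ mixedBall F G η) (hne : Ψ' ≠ Ψ) : psiObj ε C lam Ψ < psiObj ε C lam Ψ' := by
  have hv := h Ψ' hΨ'
  rw [psiObj_eq, psiObj_eq]
  obtain ⟨f₀, g₀, hfg⟩ : ∃ f g, Ψ f g ≠ Ψ' f g := by
    by_contra! hcon
    exact hne (Matrix.ext fun f g => (hcon f g).symm)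
  have hi : 0 < 1 / ε := by positivity
  have hle : ∀ f g, Real.exp ((1 / ε) * (lam f - C f g + Ψ f g)) + (1 / ε) *
      (Real.exp ((1 / ε) * (lam f - C f g + Ψ f g)) * (Ψ' f g - Ψ f g)) ≤
      Real.exp ((1 / ε) * (lam f - C f g + Ψ' f g)) := fun f g => by
    refine le_trans (le_of_eq ?_) (exp_tangent_le ((1 / ε) * (lam f - C f g + Ψ f g)) _)
    ring
  have hlt : ∑ f, ∑ g, (Real.exp ((1 / ε) * (lam f - C f g + Ψ f g)) + (1 / ε) *
      (Real.exp ((1 / ε) * (lam f - C f g + Ψ f g)) * (Ψ' f g - Ψ f g))) <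
      ∑ f, ∑ g, Real.exp ((1 / ε) * (lam f - C f g + Ψ' f g)) := by
    refine sum_lt_sum (fun f _ => sum_le_sum fun g _ => hle f g) ⟨f₀, mem_univ _, ?_⟩
    refine sum_lt_sum (fun g _ => hle f₀ g) ⟨g₀, mem_univ _, ?_⟩
    refine lt_of_eq_of_lt ?_ (exp_tangent_lt (x := (1 / ε) * (lam f₀ - C f₀ g₀ + Ψ f₀ g₀)) ?_)
    · ring
    · intro h
      exact hfg (add_left_cancel (mul_left_cancel₀ hi.ne' h))
  simp only [sum_add_distrib, ← mul_sum] at hlt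
  have := mul_nonneg hi.le hv
  linarith

/-- The truncated matrix is feasible and strictly beats every other feasible point, so existence and
uniqueness come together, without compactness. -/
lemma isPsiUpdate_iff_eq_sortedPsi (hG : 0 < G) (hε : 0 < ε) (hη : 0 ≤ η) {lam : Fin F → ℝ}
    {σ : Fin G → Equiv.Perm (Fin F)} (hσ : ∀ g, Antitone fun i => lam (σ g i) - C (σ g i) g)
    (Ψ : Matrix (Fin F) (Fin G) ℝ) :
    IsPsiUpdate ε η C lam Ψ ↔ Ψ = sortedPsi η C lam σ := by
  have hmem := sortedPsi_mem_mixedBall hG hη hσ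
  have hv := sortedPsi_variational hG hε hη hσ
  constructor
  · rintro ⟨hΨ, hmin⟩
    by_contra hne
    exact (hv.psiObj_lt hε hΨ hne).not_ge (hmin hmem)
  · rintro rfl
    refine ⟨hmem, fun Ψ' hΨ' => ?_⟩
    by_cases h : Ψ' = sortedPsi η C lam σ
    · simp [h]
    · exact (hv.psiObj_lt hε hΨ' h).le

lemma exists_sorting_perm (C : Matrix (Fin F) (Fin G) ℝ) (lam : Fin F → ℝ) :
    ∃ σ : Fin G → Equiv.Perm (Fin F), ∀ g, Antitone fun i => lam (σ g i) - C (σ g i) g := by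
  refine ⟨fun g => Tuple.sort fun f => -(lam f - C f g), fun g i j hij => ?_⟩
  have := Tuple.monotone_sort (fun f => -(lam f - C f g)) hij
  simp only [Function.comp_apply] at this
  linarith

lemma existsUnique_isPsiUpdate (hG : 0 < G) (hε : 0 < ε) (hη : 0 ≤ η) (lam : Fin F → ℝ) :
    ∃! Ψ, IsPsiUpdate ε η C lam Ψ := by
  obtain ⟨σ, hσ⟩ := exists_sorting_perm C lam
  simp only [isPsiUpdate_iff_eq_sortedPsi hG hε hη hσ]
  exact existsUnique_eq

/-- A minimiser is the truncated matrix by uniqueness, so it inherits the inequality and nothing has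
to be differentiated. -/
lemma IsPsiUpdate.variational (hG : 0 < G) (hε : 0 < ε) (hη : 0 ≤ η) {lam : Fin F → ℝ}
    {Ψ : Matrix (Fin F) (Fin G) ℝ} (h : IsPsiUpdate ε η C lam Ψ) :
    PsiVariational ε η C lam Ψ := by
  obtain ⟨σ, hσ⟩ := exists_sorting_perm C lam
  rw [(isPsiUpdate_iff_eq_sortedPsi hG hε hη hσ Ψ).1 h]
  exact sortedPsi_variational hG hε hη hσ

end Blocks

/-! ### Strong convexity, smoothness and contraction -/

section LinearRate

variable {F G : ℕ} {ε γ ζ η R : ℝ} {C : Matrix (Fin F) (Fin G) ℝ} {ν u : Fin F → ℝ}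

/-- All arguments of the exponentials in the dual objective are bounded by `R`. -/
def ArgBound (ε γ ζ R : ℝ) (C : Matrix (Fin F) (Fin G) ℝ) (lam : Fin F → ℝ)
    (Ψ : Matrix (Fin F) (Fin G) ℝ) : Prop :=
  ∀ f, |-(γ * ζ) * lam f| ≤ R ∧ ∀ g, |(1 / ε) * (lam f - C f g + Ψ f g)| ≤ R

/-- The directional derivative of the dual objective in its first block. -/
noncomputable def lamSlope (ε γ ζ : ℝ) (C : Matrix (Fin F) (Fin G) ℝ) (ν u lam : Fin F → ℝ)
    (Ψ : Matrix (Fin F) (Fin G) ℝ) (d : Fin F → ℝ) : ℝ :=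
  ∑ f, γ * ζ * (∑ g, Real.exp ((1 / ε) * (lam f - C f g + Ψ f g))
    - nuZero γ ν u f * Real.exp (-(γ * ζ) * lam f)) * d f

lemma lamSlope_eq (hε : 0 < ε) (lam : Fin F → ℝ) (Ψ : Matrix (Fin F) (Fin G) ℝ)
    (d : Fin F → ℝ) :
    lamSlope ε γ ζ C ν u lam Ψ d =
      γ * ζ * ε * ∑ f, ∑ g, Real.exp ((1 / ε) * (lam f - C f g + Ψ f g)) * ((1 / ε) * d f)
      + ∑ f, nuZero γ ν u f * (Real.exp (-(γ * ζ) * lam f) * (-(γ * ζ) * d f)) := by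
  rw [mul_sum, ← sum_add_distrib]
  refine sum_congr rfl fun f _ => ?_
  rw [← sum_mul]
  field_simp
  ring

lemma lamSlope_lamUpdate (hG : 0 < G) (hε : 0 < ε) (hγ : 0 < γ) (hζ : 0 < ζ)
    (hν : ∀ f, 0 < ν f) (Ψ : Matrix (Fin F) (Fin G) ℝ) (d : Fin F → ℝ) :
    lamSlope ε γ ζ C ν u (lamUpdate ε γ ζ C ν u Ψ) Ψ d = 0 := by
  refine sum_eq_zero fun f _ => ?_
  rw [sum_exp_eq_mul_xi, lamUpdate_stationary hG hε hγ hζ hν]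
  ring

/-- Strong convexity of the dual objective, at a point that is optimal in its second block. -/
lemma dualObj_strong_lower (hε : 0 < ε) (hγ : 0 < γ) (hζ : 0 < ζ) (hν : ∀ f, 0 < ν f)
    {lam lam' : Fin F → ℝ} {Ψ Ψ' : Matrix (Fin F) (Fin G) ℝ}
    (hb : ArgBound ε γ ζ R C lam Ψ) (hb' : ArgBound ε γ ζ R C lam' Ψ')
    (hv : PsiVariational ε η C lam Ψ) (hΨ' : Ψ' ∈ mixedBall F G η) :
    dualObj ε γ ζ C ν u lam Ψ + lamSlope ε γ ζ C ν u lam Ψ (lam' - lam)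
      + γ * ζ * ε * (Real.exp (-R) / 2 * (1 / ε) ^ 2) *
        ∑ f, ∑ g, (lam' f - lam f + (Ψ' f g - Ψ f g)) ^ 2
      + Real.exp (-R) / 2 * (γ * ζ) ^ 2 * ∑ f, nuZero γ ν u f * (lam' f - lam f) ^ 2
      ≤ dualObj ε γ ζ C ν u lam' Ψ' := by
  have hA : 0 < γ * ζ * ε := by positivity
  have h1 : ∑ f, ∑ g, (Real.exp ((1 / ε) * (lam f - C f g + Ψ f g))
      + Real.exp ((1 / ε) * (lam f - C f g + Ψ f g)) * ((1 / ε) * (lam' - lam) f)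
      + (1 / ε) * (Real.exp ((1 / ε) * (lam f - C f g + Ψ f g)) * (Ψ' f g - Ψ f g))
      + Real.exp (-R) / 2 * (1 / ε) ^ 2 * (lam' f - lam f + (Ψ' f g - Ψ f g)) ^ 2)
      ≤ ∑ f, ∑ g, Real.exp ((1 / ε) * (lam' f - C f g + Ψ' f g)) := by
    refine sum_le_sum fun f _ => sum_le_sum fun g _ => ?_
    refine le_trans (le_of_eq ?_)
      (exp_lower_bound (neg_le_of_abs_le ((hb f).2 g)) (neg_le_of_abs_le ((hb' f).2 g)))
    rw [Pi.sub_apply]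
    ring
  have h2 : ∑ f, (nuZero γ ν u f * Real.exp (-(γ * ζ) * lam f)
      + nuZero γ ν u f * (Real.exp (-(γ * ζ) * lam f) * (-(γ * ζ) * (lam' - lam) f))
      + Real.exp (-R) / 2 * (γ * ζ) ^ 2 * (nuZero γ ν u f * (lam' f - lam f) ^ 2))
      ≤ ∑ f, nuZero γ ν u f * Real.exp (-(γ * ζ) * lam' f) := by
    refine sum_le_sum fun f _ => ?_
    refine le_trans (le_of_eq ?_) (mul_le_mul_of_nonneg_left
      (exp_lower_bound (neg_le_of_abs_le (hb f).1) (neg_le_of_abs_le (hb' f).1))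
      (nuZero_pos hν f).le)
    rw [Pi.sub_apply]
    ring
  -- The `Ψ`-part of the first-order term is nonnegative, so the final bound drops it.
  have h3 := mul_nonneg hA.le (mul_nonneg (one_div_pos.2 hε).le (hv Ψ' hΨ'))
  have h4 := mul_le_mul_of_nonneg_left h1 hA.le
  rw [lamSlope_eq hε, dualObj_eq, dualObj_eq]
  simp only [sum_add_distrib, ← mul_sum, mul_add] at h2 h4
  simp only [mul_assoc, mul_add] at h2 h3 h4 ⊢
  linarith

/-- Smoothness of the dual objective in its first block. -/
lemma dualObj_upper (hε : 0 < ε) (hγ : 0 < γ) (hζ : 0 < ζ) (hν : ∀ f, 0 < ν f)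
    {lam lam' : Fin F → ℝ} {Ψ : Matrix (Fin F) (Fin G) ℝ}
    (hb : ArgBound ε γ ζ R C lam Ψ) (hb' : ArgBound ε γ ζ R C lam' Ψ) {t : ℝ}
    (ht0 : 0 ≤ t) (ht1 : t ≤ 1) :
    dualObj ε γ ζ C ν u (lam + t • (lam' - lam)) Ψ ≤
      dualObj ε γ ζ C ν u lam Ψ + t * lamSlope ε γ ζ C ν u lam Ψ (lam' - lam)
      + t ^ 2 / 2 * ∑ f, (γ * ζ * ε * (Real.exp R * (1 / ε) ^ 2 * G)
        + Real.exp R * (γ * ζ) ^ 2 * nuZero γ ν u f) * (lam' f - lam f) ^ 2 := by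
  have hA : 0 < γ * ζ * ε := by positivity
  -- The upper bound `R` persists along the segment because the arguments are affine in `t`.
  have hconv : ∀ {x y : ℝ}, |x| ≤ R → |y| ≤ R → x + t * (y - x) ≤ R := fun hx hy => by
    nlinarith [le_of_abs_le hx, le_of_abs_le hy]
  have h1 : ∑ f, ∑ g, Real.exp ((1 / ε) * ((lam + t • (lam' - lam)) f - C f g + Ψ f g)) ≤
      ∑ f, ∑ g, (Real.exp ((1 / ε) * (lam f - C f g + Ψ f g))
      + t * (Real.exp ((1 / ε) * (lam f - C f g + Ψ f g)) * ((1 / ε) * (lam' - lam) f))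
      + t ^ 2 / 2 * (Real.exp R * (1 / ε) ^ 2 * (lam' f - lam f) ^ 2)) := by
    refine sum_le_sum fun f _ => sum_le_sum fun g _ => ?_
    refine le_trans (exp_upper_bound (R := R) (le_of_abs_le ((hb f).2 g)) ?_) (le_of_eq ?_)
    · refine le_trans (le_of_eq ?_) (hconv ((hb f).2 g) ((hb' f).2 g))
      simp only [Pi.add_apply, Pi.smul_apply, Pi.sub_apply, smul_eq_mul]
      ring
    · simp only [Pi.add_apply, Pi.smul_apply, Pi.sub_apply, smul_eq_mul]
      ring
  have h2 : ∑ f, nuZero γ ν u f * Real.exp (-(γ * ζ) * (lam + t • (lam' - lam)) f) ≤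
      ∑ f, (nuZero γ ν u f * Real.exp (-(γ * ζ) * lam f)
      + t * (nuZero γ ν u f * (Real.exp (-(γ * ζ) * lam f) * (-(γ * ζ) * (lam' - lam) f)))
      + t ^ 2 / 2 * (Real.exp R * (γ * ζ) ^ 2 * nuZero γ ν u f * (lam' f - lam f) ^ 2)) := by
    refine sum_le_sum fun f _ => ?_
    refine le_trans (mul_le_mul_of_nonneg_left (exp_upper_bound (R := R)
      (le_of_abs_le (hb f).1) ?_) (nuZero_pos hν f).le) (le_of_eq ?_)
    · refine le_trans (le_of_eq ?_) (hconv (hb f).1 (hb' f).1)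
      simp only [Pi.add_apply, Pi.smul_apply, Pi.sub_apply, smul_eq_mul]
      ring
    · simp only [Pi.add_apply, Pi.smul_apply, Pi.sub_apply, smul_eq_mul]
      ring
  have h4 := mul_le_mul_of_nonneg_left h1 hA.le
  have h5 : ∑ f, (γ * ζ * ε * (Real.exp R * (1 / ε) ^ 2 * G)
        + Real.exp R * (γ * ζ) ^ 2 * nuZero γ ν u f) * (lam' f - lam f) ^ 2 =
      γ * ζ * ε * ∑ f, ∑ _g : Fin G, Real.exp R * (1 / ε) ^ 2 * (lam' f - lam f) ^ 2
      + ∑ f, Real.exp R * (γ * ζ) ^ 2 * nuZero γ ν u f * (lam' f - lam f) ^ 2 := by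
    rw [mul_sum, ← sum_add_distrib]
    refine sum_congr rfl fun f _ => ?_
    rw [sum_const, card_univ, Fintype.card_fin, nsmul_eq_mul]
    ring
  rw [lamSlope_eq hε, dualObj_eq, dualObj_eq, h5]
  simp only [sum_add_distrib, ← mul_sum, mul_add] at h2 h4 ⊢
  linarith

/-- One exact minimisation in the first block contracts the optimality gap. -/
lemma dualObj_lamUpdate_contract (hG : 0 < G) (hε : 0 < ε) (hγ : 0 < γ) (hζ : 0 < ζ)
    (hν : ∀ f, 0 < ν f) {lam lam' : Fin F → ℝ} {Ψ Ψ' : Matrix (Fin F) (Fin G) ℝ}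
    (hb : ArgBound ε γ ζ R C lam Ψ) (hb' : ArgBound ε γ ζ R C lam' Ψ')
    (hb'' : ArgBound ε γ ζ R C lam' Ψ)
    (hv : PsiVariational ε η C lam Ψ) (hΨ' : Ψ' ∈ mixedBall F G η) {t : ℝ}
    (ht0 : 0 ≤ t) (ht1 : t ≤ 1)
    (ht : ∀ f, t * (γ * ζ * ε * (Real.exp R * (1 / ε) ^ 2 * G)
        + Real.exp R * (γ * ζ) ^ 2 * nuZero γ ν u f) ≤
        Real.exp (-R) * (γ * ζ) ^ 2 * nuZero γ ν u f) :
    dualObj ε γ ζ C ν u (lamUpdate ε γ ζ C ν u Ψ) Ψ ≤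
      dualObj ε γ ζ C ν u lam Ψ
        + t * (dualObj ε γ ζ C ν u lam' Ψ' - dualObj ε γ ζ C ν u lam Ψ) := by
  have hlow := dualObj_strong_lower (u := u) hε hγ hζ hν hb hb' hv hΨ'
  have hup := dualObj_upper (u := u) hε hγ hζ hν hb hb'' ht0 ht1
  have hmin := dualObj_lamUpdate_le (C := C) (u := u) hG hε hγ hζ hν Ψ (lam + t • (lam' - lam))
  have hq : 0 ≤ γ * ζ * ε * (Real.exp (-R) / 2 * (1 / ε) ^ 2) *
      ∑ f, ∑ g, (lam' f - lam f + (Ψ' f g - Ψ f g)) ^ 2 :=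
    mul_nonneg (by positivity) (sum_nonneg fun f _ => sum_nonneg fun g _ => sq_nonneg _)
  -- The choice of `t` makes the smoothness term at most `t` times the strong-convexity term, so the
  -- upper bound is dominated by `t` times the lower one.
  have hquad : t ^ 2 / 2 * ∑ f, (γ * ζ * ε * (Real.exp R * (1 / ε) ^ 2 * G)
        + Real.exp R * (γ * ζ) ^ 2 * nuZero γ ν u f) * (lam' f - lam f) ^ 2 ≤
      t * (Real.exp (-R) / 2 * (γ * ζ) ^ 2 *
        ∑ f, nuZero γ ν u f * (lam' f - lam f) ^ 2) := by
    rw [mul_sum, mul_sum, mul_sum]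
    refine sum_le_sum fun f _ => ?_
    have := mul_le_mul_of_nonneg_left (ht f)
      (mul_nonneg (half_pos one_pos).le (mul_nonneg ht0 (sq_nonneg (lam' f - lam f))))
    linarith
  have := mul_le_mul_of_nonneg_left hlow ht0
  nlinarith [mul_nonneg ht0 hq]

/-- Finitely many conditions hold for all small `t > 0`; the cap `1 / 2` keeps `1 - t`, hence the
rate, positive. -/
lemma exists_contraction_factor (hγ : 0 < γ) (hζ : 0 < ζ) (hν : ∀ f, 0 < ν f)
    (a : Fin F → ℝ) (R : ℝ) :
    ∃ t : ℝ, 0 < t ∧ t ≤ 1 / 2 ∧ ∀ f, t * a f ≤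
      Real.exp (-R) * (γ * ζ) ^ 2 * nuZero γ ν u f := by
  have h1 : ∀ᶠ t in nhdsWithin (0 : ℝ) (Set.Ioi 0), ∀ f, t * a f ≤
      Real.exp (-R) * (γ * ζ) ^ 2 * nuZero γ ν u f := by
    refine Filter.eventually_all.2 fun f => ?_
    have hpos : 0 * a f < Real.exp (-R) * (γ * ζ) ^ 2 * nuZero γ ν u f := by
      have := nuZero_pos (γ := γ) (u := u) hν f
      rw [zero_mul]
      positivity
    have ht : Filter.Tendsto (fun t : ℝ => t * a f) (nhdsWithin 0 (Set.Ioi 0))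
        (nhds (0 * a f)) :=
      ((continuous_id.mul continuous_const).tendsto 0).mono_left nhdsWithin_le_nhds
    exact ht.eventually_le_const hpos
  have h2 : ∀ᶠ t in nhdsWithin (0 : ℝ) (Set.Ioi 0), t ∈ Set.Ioc (0 : ℝ) (1 / 2) :=
    Ioc_mem_nhdsGT (by norm_num)
  obtain ⟨t, ht, ht'⟩ := (h1.and h2).exists
  exact ⟨t, ht'.1, ht'.2, ht⟩

/-- The optimality gap bounds the squared distance to a stationary point. -/
lemma exists_pairDist_sq_le (hG : 0 < G) (hε : 0 < ε) (hγ : 0 < γ) (hζ : 0 < ζ)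
    (hν : ∀ f, 0 < ν f) {Ψ : Matrix (Fin F) (Fin G) ℝ}
    (hb : ArgBound ε γ ζ R C (lamUpdate ε γ ζ C ν u Ψ) Ψ)
    (hv : PsiVariational ε η C (lamUpdate ε γ ζ C ν u Ψ) Ψ) :
    ∃ K : ℝ, 0 ≤ K ∧ ∀ (lam' : Fin F → ℝ) (Ψ' : Matrix (Fin F) (Fin G) ℝ),
      ArgBound ε γ ζ R C lam' Ψ' → Ψ' ∈ mixedBall F G η →
      pairDist lam' Ψ' (lamUpdate ε γ ζ C ν u Ψ) Ψ ^ 2 ≤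
        K * (dualObj ε γ ζ C ν u lam' Ψ' -
          dualObj ε γ ζ C ν u (lamUpdate ε γ ζ C ν u Ψ) Ψ) := by
  set m := lamUpdate ε γ ζ C ν u Ψ with hm
  set α := γ * ζ * ε * (Real.exp (-R) / 2 * (1 / ε) ^ 2) with hα
  set β := Real.exp (-R) / 2 * (γ * ζ) ^ 2 with hβ
  have hα0 : 0 < α := by positivity
  have hβ0 : 0 < β := by positivity
  -- `1 + 2 * G` is one copy of the `lam`-distance plus the `2 * G` copies spent in `hP` on
  -- decoupling `Ψ` from `lam`.
  have h1 : ∀ᶠ K in (Filter.atTop : Filter ℝ), ∀ f, (1 + 2 * G : ℝ) ≤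
      K * (β * nuZero γ ν u f) :=
    Filter.eventually_all.2 fun f => (Filter.tendsto_id.atTop_mul_const
      (mul_pos hβ0 (nuZero_pos hν f))).eventually_ge_atTop _
  have h2 : ∀ᶠ K in (Filter.atTop : Filter ℝ), 2 ≤ K * α :=
    (Filter.tendsto_id.atTop_mul_const hα0).eventually_ge_atTop _
  obtain ⟨K, ⟨hK1, hK2⟩, hK0⟩ := ((h1.and h2).and (Filter.eventually_ge_atTop 0)).exists
  refine ⟨K, hK0, fun lam' Ψ' hb' hΨ' => ?_⟩
  have hlow := dualObj_strong_lower (u := u) hε hγ hζ hν hb hb' hv hΨ'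
  rw [hm, lamSlope_lamUpdate hG hε hγ hζ hν, ← hm, ← hα, ← hβ] at hlow
  have hsq : pairDist lam' Ψ' m Ψ ^ 2 =
      ∑ f, (lam' f - m f) ^ 2 + ∑ f, ∑ g, (Ψ' f g - Ψ f g) ^ 2 := by
    rw [pairDist, Real.sq_sqrt]
    exact add_nonneg (sum_nonneg fun _ _ => sq_nonneg _)
      (sum_nonneg fun _ _ => sum_nonneg fun _ _ => sq_nonneg _)
  have hP : ∑ f, ∑ g, (Ψ' f g - Ψ f g) ^ 2 ≤
      2 * ∑ f, ∑ g, (lam' f - m f + (Ψ' f g - Ψ f g)) ^ 2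
        + 2 * G * ∑ f, (lam' f - m f) ^ 2 := by
    rw [mul_sum, mul_sum, ← sum_add_distrib]
    refine sum_le_sum fun f _ => ?_
    have : (2 * G : ℝ) * (lam' f - m f) ^ 2 = ∑ _g : Fin G, 2 * (lam' f - m f) ^ 2 := by
      rw [sum_const, card_univ, Fintype.card_fin, nsmul_eq_mul]
      ring
    rw [this, mul_sum, ← sum_add_distrib]
    refine sum_le_sum fun g _ => ?_
    -- `2(a + b)² + 2a² - b² = (2a + b)²`.
    nlinarith [sq_nonneg (2 * (lam' f - m f) + (Ψ' f g - Ψ f g))]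
  have hD : (1 + 2 * G : ℝ) * ∑ f, (lam' f - m f) ^ 2 ≤
      K * (β * ∑ f, nuZero γ ν u f * (lam' f - m f) ^ 2) := by
    rw [mul_sum, mul_sum, mul_sum]
    refine sum_le_sum fun f _ => ?_
    have := mul_le_mul_of_nonneg_right (hK1 f) (sq_nonneg (lam' f - m f))
    linarith
  have hDP : 2 * ∑ f, ∑ g, (lam' f - m f + (Ψ' f g - Ψ f g)) ^ 2 ≤
      K * (α * ∑ f, ∑ g, (lam' f - m f + (Ψ' f g - Ψ f g)) ^ 2) := by
    have := mul_le_mul_of_nonneg_right hK2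
      (sum_nonneg fun f _ => sum_nonneg fun g _ =>
        sq_nonneg (lam' f - m f + (Ψ' f g - Ψ f g)) :
        0 ≤ ∑ f, ∑ g, (lam' f - m f + (Ψ' f g - Ψ f g)) ^ 2)
    linarith
  have := mul_le_mul_of_nonneg_left hlow hK0
  rw [hsq]
  linarith

end LinearRate

/-! ### Existence of a solution and uniform bounds -/

section Compactness

variable {F G : ℕ} {ε γ ζ η : ℝ} {C : Matrix (Fin F) (Fin G) ℝ} {ν u : Fin F → ℝ}

lemma abs_entry_le_of_mem_mixedBall (hG : 0 < G) {Ψ : Matrix (Fin F) (Fin G) ℝ}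
    (h : Ψ ∈ mixedBall F G η) (f : Fin F) (g : Fin G) : |Ψ f g| ≤ η :=
  (single_le_sum (f := fun f => |Ψ f g|) (fun _ _ => abs_nonneg _) (mem_univ f)).trans
    ((mem_mixedBall_iff hG).1 h g)

lemma isCompact_mixedBall (hG : 0 < G) : IsCompact (mixedBall F G η) := by
  have hc : IsCompact (Set.pi Set.univ fun _ => Set.pi Set.univ fun _ => Set.Icc (-η) η :
      Set (Fin F → Fin G → ℝ)) :=
    isCompact_univ_pi fun _ => isCompact_univ_pi fun _ => isCompact_Icc
  refine IsCompact.of_isClosed_subset hc ?_ fun Ψ hΨ f _ g _ =>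
    abs_le.1 (abs_entry_le_of_mem_mixedBall hG hΨ f g)
  have : mixedBall F G η = ⋂ g, {Ψ : Matrix (Fin F) (Fin G) ℝ | ∑ f, |Ψ f g| ≤ η} := by
    ext Ψ
    rw [mem_mixedBall_iff hG, Set.mem_iInter]
    rfl
  rw [this]
  refine isClosed_iInter fun g => isClosed_le ?_ continuous_const
  exact continuous_finsetSum _ fun f _ => (continuous_apply_apply f g).abs

lemma continuous_lamUpdate (hG : 0 < G) : Continuous (lamUpdate ε γ ζ C ν u) := by
  refine continuous_pi fun f => continuous_const.mul (continuous_const.sub (Continuous.log ?_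
    fun Ψ => (xi_pos hG Ψ f).ne'))
  exact continuous_finsetSum _ fun g _ => Real.continuous_exp.comp
    (continuous_const.add (continuous_const.mul (continuous_apply_apply f g)))

/-- Eliminating the unbounded variable `lam` by its exact minimiser leaves a continuous function on
the compact ball. -/
lemma exists_isDualSolution_lamUpdate (hG : 0 < G) (hε : 0 < ε) (hγ : 0 < γ) (hζ : 0 < ζ)
    (hη : 0 ≤ η) (hν : ∀ f, 0 < ν f) :
    ∃ Ψ, IsDualSolution ε γ ζ η C ν u (lamUpdate ε γ ζ C ν u Ψ) Ψ := by
  have hlam : ∀ f, Continuous fun Ψ => lamUpdate ε γ ζ C ν u Ψ f := fun f =>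
    (continuous_apply f).comp (continuous_lamUpdate hG)
  have hcont : Continuous fun Ψ => dualObj ε γ ζ C ν u (lamUpdate ε γ ζ C ν u Ψ) Ψ := by
    simp only [dualObj_eq]
    refine (continuous_const.mul (continuous_finsetSum _ fun f _ => continuous_finsetSum _
      fun g _ => Real.continuous_exp.comp (continuous_const.mul
        (((hlam f).sub continuous_const).add (continuous_apply_apply f g))))).add
      (continuous_finsetSum _ fun f _ => continuous_const.mul
        (Real.continuous_exp.comp (continuous_const.mul (hlam f))))
  have hne : (mixedBall F G η).Nonempty := ⟨0, (mem_mixedBall_iff hG).2 fun g => by simpa⟩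
  obtain ⟨Ψ, hΨ, hmin⟩ := (isCompact_mixedBall hG).exists_isMinOn hne hcont.continuousOn
  exact ⟨Ψ, hΨ, fun lam' Ψ' hΨ' =>
    (hmin hΨ').trans (dualObj_lamUpdate_le hG hε hγ hζ hν Ψ' lam')⟩

/-- On the ball, points whose first block comes from `lamUpdate` are uniformly bounded. -/
lemma exists_argBound (hG : 0 < G) (hε : 0 < ε) (hγ : 0 < γ) (hζ : 0 < ζ) :
    -- `Φ` and `Ψ` are independent because the contraction also pairs the optimal `lam` with the
    -- current `Ψ`.
    ∃ R : ℝ, ∀ Φ ∈ mixedBall F G η, ∀ Ψ ∈ mixedBall F G η,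
      ArgBound ε γ ζ R C (lamUpdate ε γ ζ C ν u Φ) Ψ := by
  obtain ⟨B, hB⟩ := (isCompact_mixedBall (F := F) (η := η) hG).exists_bound_of_continuousOn
    (continuous_lamUpdate (ε := ε) (γ := γ) (ζ := ζ) (C := C) (ν := ν) (u := u) hG).continuousOn
  have hBf : ∀ Φ ∈ mixedBall F G η, ∀ f, |lamUpdate ε γ ζ C ν u Φ f| ≤ B := fun Φ hΦ f =>
    (norm_le_pi_norm (lamUpdate ε γ ζ C ν u Φ) f).trans (hB Φ hΦ)
  have hgz : 0 < γ * ζ := mul_pos hγ hζ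
  have hi : 0 < 1 / ε := one_div_pos.2 hε
  refine ⟨max (γ * ζ * B) ((1 / ε) * (B + ∑ f, ∑ g, |C f g| + η)), fun Φ hΦ Ψ hΨ f => ⟨?_, ?_⟩⟩
  · refine le_trans ?_ (le_max_left _ _)
    rw [abs_mul, abs_neg, abs_of_pos hgz]
    exact mul_le_mul_of_nonneg_left (hBf Φ hΦ f) hgz.le
  · intro g
    refine le_trans ?_ (le_max_right _ _)
    rw [abs_mul, abs_of_pos hi]
    refine mul_le_mul_of_nonneg_left ?_ hi.le
    have hC : |C f g| ≤ ∑ f, ∑ g, |C f g| :=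
      (single_le_sum (f := fun g => |C f g|) (fun _ _ => abs_nonneg _) (mem_univ g)).trans
        (single_le_sum (f := fun f => ∑ g, |C f g|)
          (fun _ _ => sum_nonneg fun _ _ => abs_nonneg _) (mem_univ f))
    have h1 := abs_add_le (lamUpdate ε γ ζ C ν u Φ f - C f g) (Ψ f g)
    have h2 := abs_sub (lamUpdate ε γ ζ C ν u Φ f) (C f g)
    have h3 := abs_entry_le_of_mem_mixedBall hG hΨ f g
    have h4 := hBf Φ hΦ f
    linarith

end Compactness

/-! ### Linear convergence of the iterates -/

section Convergence

variable {F G : ℕ} {ε γ ζ η : ℝ} {C : Matrix (Fin F) (Fin G) ℝ} {ν u : Fin F → ℝ}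

/-- A tail bound `d (k + 2) ^ 2 ≤ M (ρ ^ 2) ^ k` makes `d` decay like `ρ ^ k`. -/
lemma exists_le_mul_pow_of_tail {d : ℕ → ℝ} {M ρ : ℝ} (hρ : 0 < ρ) (hd : ∀ k, 0 ≤ d k)
    (h : ∀ k, d (k + 2) ^ 2 ≤ M * (ρ ^ 2) ^ k) : ∃ c : ℝ, ∀ k, d k ≤ c * ρ ^ k := by
  have hM : 0 ≤ M := by simpa using (sq_nonneg _).trans (h 0)
  -- One summand for each of the two unconstrained initial terms and one for the tail.
  refine ⟨d 0 + d 1 / ρ + Real.sqrt M / ρ ^ 2, fun k => ?_⟩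
  have h0 := hd 0
  have h1 : 0 ≤ d 1 / ρ := div_nonneg (hd 1) hρ.le
  have h2 : 0 ≤ Real.sqrt M / ρ ^ 2 := by positivity
  match k with
  | 0 => simp only [pow_zero, mul_one]; linarith
  | 1 =>
    have : d 1 = d 1 / ρ * ρ ^ 1 := by field_simp
    nlinarith
  | k + 2 =>
    have hk : d (k + 2) ≤ Real.sqrt M * ρ ^ k := by
      refine abs_le_of_sq_le_sq' ?_ (by positivity) |>.2
      rw [mul_pow, Real.sq_sqrt hM, ← pow_mul, mul_comm k 2, pow_mul]
      exact h k
    have : Real.sqrt M * ρ ^ k = Real.sqrt M / ρ ^ 2 * ρ ^ (k + 2) := by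
      rw [pow_add]
      field_simp
    rw [this] at hk
    refine hk.trans (mul_le_mul_of_nonneg_right (by linarith) (by positivity))

lemma exists_linear_rate (hG : 0 < G) (hε : 0 < ε) (hγ : 0 < γ) (hζ : 0 < ζ)
    (hη : 0 ≤ η) (hν : ∀ f, 0 < ν f) :
    ∃ ρ : ℝ, 0 < ρ ∧ ρ < 1 ∧
      ∀ (lam : ℕ → Fin F → ℝ) (Psi : ℕ → Matrix (Fin F) (Fin G) ℝ),
        IsIterates ε γ ζ η C ν u lam Psi →
        ∃ (lamStar : Fin F → ℝ) (PsiStar : Matrix (Fin F) (Fin G) ℝ),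
          IsDualSolution ε γ ζ η C ν u lamStar PsiStar ∧
          ∃ c : ℝ, ∀ k, pairDist (lam k) (Psi k) lamStar PsiStar ≤ c * ρ ^ k := by
  obtain ⟨S, hS⟩ := exists_isDualSolution_lamUpdate (C := C) (u := u) hG hε hγ hζ hη hν
  obtain ⟨R, hR⟩ := exists_argBound (η := η) (C := C) (ν := ν) (u := u) hG hε hγ hζ
  obtain ⟨t, ht0, ht1, ht⟩ := exists_contraction_factor (u := u) hγ hζ hν
    (fun f => γ * ζ * ε * (Real.exp R * (1 / ε) ^ 2 * G)
      + Real.exp R * (γ * ζ) ^ 2 * nuZero γ ν u f) R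
  have hSv : PsiVariational ε η C (lamUpdate ε γ ζ C ν u S) S :=
    ((isPsiUpdate_iff_dualObj (ν := ν) (u := u) hε hγ hζ _ S).2
      ⟨hS.1, fun Ψ' hΨ' => hS.2 _ Ψ' hΨ'⟩).variational hG hε hη
  obtain ⟨K, hK0, hK⟩ := exists_pairDist_sq_le hG hε hγ hζ hν (hR S hS.1 S hS.1) hSv
  refine ⟨Real.sqrt (1 - t), Real.sqrt_pos.2 (by linarith),
    (Real.sqrt_lt' one_pos).2 (by linarith), fun lam Psi hit => ?_⟩
  refine ⟨_, S, hS, ?_⟩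
  set J := dualObj ε γ ζ C ν u with hJ
  have hmem : ∀ k, Psi (k + 1) ∈ mixedBall F G η := fun k => (hit k).2.1
  -- `Psi 0` may lie outside the ball, so `lam 1` has no uniform bound; from `lam 2` on `R` applies,
  -- and `t` is independent of the start.
  have hbd : ∀ k, ∀ Ψ ∈ mixedBall F G η, ArgBound ε γ ζ R C (lam (k + 2)) Ψ := fun k Ψ hΨ => by
    rw [(hit (k + 1)).1]
    exact hR _ (hmem k) Ψ hΨ
  have hstep : ∀ k, J (lam (k + 3)) (Psi (k + 3)) - J (lamUpdate ε γ ζ C ν u S) S ≤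
      (1 - t) * (J (lam (k + 2)) (Psi (k + 2)) - J (lamUpdate ε γ ζ C ν u S) S) := by
    intro k
    have h1 := dualObj_lamUpdate_contract hG hε hγ hζ hν (hbd k _ (hmem (k + 1)))
      (hR S hS.1 S hS.1) (hR S hS.1 _ (hmem (k + 1)))
      ((hit (k + 1)).2.variational hG hε hη) hS.1 ht0.le (by linarith) ht
    have h2 := ((isPsiUpdate_iff_dualObj (ν := ν) (u := u) hε hγ hζ _ _).1
      (hit (k + 2)).2).2 (Psi (k + 2)) (hmem (k + 1))
    rw [← (hit (k + 2)).1] at h1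
    rw [← hJ] at h1 h2
    change J (lam (k + 3)) (Psi (k + 3)) ≤ J (lam (k + 3)) (Psi (k + 2)) at h2
    change J (lam (k + 3)) (Psi (k + 2)) ≤ J (lam (k + 2)) (Psi (k + 2)) + t *
      (J (lamUpdate ε γ ζ C ν u S) S - J (lam (k + 2)) (Psi (k + 2))) at h1
    linarith
  have hgap : ∀ k, J (lam (k + 2)) (Psi (k + 2)) - J (lamUpdate ε γ ζ C ν u S) S ≤
      (1 - t) ^ k * (J (lam 2) (Psi 2) - J (lamUpdate ε γ ζ C ν u S) S) := by
    intro k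
    induction k with
    | zero => simp
    | succ k ih =>
      refine (hstep k).trans ?_
      rw [pow_succ', mul_assoc]
      exact mul_le_mul_of_nonneg_left ih (by linarith)
  refine exists_le_mul_pow_of_tail (M := K * (J (lam 2) (Psi 2)
    - J (lamUpdate ε γ ζ C ν u S) S)) (Real.sqrt_pos.2 (by linarith))
    (fun _ => Real.sqrt_nonneg _) fun k => ?_
  rw [Real.sq_sqrt (by linarith)]
  refine (hK _ _ (hbd k _ (hmem (k + 1))) (hmem (k + 1))).trans ?_
  exact (mul_le_mul_of_nonneg_left (hgap k) hK0).trans (le_of_eq (by ring))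

end Convergence

end PitchDual

theorem proposition2 {F G : ℕ} (hG : 0 < G) (ε γ ζ η : ℝ)
    (hε : 0 < ε) (hγ : 0 < γ) (hζ : 0 < ζ) (hη : 0 ≤ η)
    (C : Matrix (Fin F) (Fin G) ℝ) (ν u : Fin F → ℝ) (hν : ∀ f, 0 < ν f) :
    -- the closed-form update is the exact, unique minimisation in the first block
    (∀ (Ψ : Matrix (Fin F) (Fin G) ℝ) (lam : Fin F → ℝ),
      lam = PitchDual.lamUpdate ε γ ζ C ν u Ψ ↔
        ∀ lam' : Fin F → ℝ,
          PitchDual.dualObj ε γ ζ C ν u lam Ψ ≤ PitchDual.dualObj ε γ ζ C ν u lam' Ψ) ∧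
    -- the second update is well defined and is the exact minimisation in the second block
    (∀ lam : Fin F → ℝ, ∃! Ψ, PitchDual.IsPsiUpdate ε η C lam Ψ) ∧
    (∀ (lam : Fin F → ℝ) (Ψ : Matrix (Fin F) (Fin G) ℝ),
      PitchDual.IsPsiUpdate ε η C lam Ψ ↔
        Ψ ∈ PitchDual.mixedBall F G η ∧
          ∀ Ψ' ∈ PitchDual.mixedBall F G η,
            PitchDual.dualObj ε γ ζ C ν u lam Ψ ≤ PitchDual.dualObj ε γ ζ C ν u lam Ψ') ∧
    -- the second update is computed by sorting each column of `lam_f - C_{f,g}`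
    (∀ (lam : Fin F → ℝ) (σ : Fin G → Equiv.Perm (Fin F)),
      (∀ g, Antitone fun i => lam (σ g i) - C (σ g i) g) →
      ∀ Ψ : Matrix (Fin F) (Fin G) ℝ,
        PitchDual.IsPsiUpdate ε η C lam Ψ ↔
          ∀ f g, Ψ f g =
            -max (lam f - C f g -
              PitchDual.sortedThreshold η (fun i => lam (σ g i) - C (σ g i) g)) 0) ∧
    -- linear convergence of the iterates to a solution of the dual problem
    (∃ ρ : ℝ, 0 < ρ ∧ ρ < 1 ∧
      ∀ (lam : ℕ → Fin F → ℝ) (Psi : ℕ → Matrix (Fin F) (Fin G) ℝ),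
        PitchDual.IsIterates ε γ ζ η C ν u lam Psi →
        ∃ (lamStar : Fin F → ℝ) (PsiStar : Matrix (Fin F) (Fin G) ℝ),
          PitchDual.IsDualSolution ε γ ζ η C ν u lamStar PsiStar ∧
          ∃ c : ℝ, ∀ k,
            PitchDual.pairDist (lam k) (Psi k) lamStar PsiStar ≤ c * ρ ^ k) := by
  refine ⟨PitchDual.eq_lamUpdate_iff hG hε hγ hζ hν,
    PitchDual.existsUnique_isPsiUpdate hG hε hη,
    PitchDual.isPsiUpdate_iff_dualObj hε hγ hζ, fun lam σ hσ Ψ => ?_,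
    PitchDual.exists_linear_rate hG hε hγ hζ hη hν⟩
  rw [PitchDual.isPsiUpdate_iff_eq_sortedPsi hG hε hη hσ]
  exact Matrix.ext_iff.symm
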